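/- For $n\in\mathbb{N}=\{0,1,2,\dots\}$ let $(n)_2$ denote the canonical base-$2$ representation of $n$ (most significant digit first, no leading zeros, so $(0)_2$ is the empty word), and let $S_>$ be the set of all $n\in\mathbb{N}$ such that $(n)_2$ contains strictly more $0$s than $1$s. Sums may have repeated summands, and the empty sum is $0$. (a) A natural number is a sum of at most three elements of $S_>$ if and only if it is not one of $$1, 2, 3, 5, 6, 7, 9, 10, 11, 13, 14, 15, 19, 23, 27, 31, 47, 63.$$ (b) The number $3$ is optimal: $3$ is the least $m$ such that every sufficiently large natural number is a sum of at most $m$ elements of $S_>$. In particular, infinitely many natural numbers are not a sum of at most two elements of $S_>$. (c) A natural number is a sum of at most three natural numbers whose base-$2$ representations lie in the regular language $L_4 = 10(01+10+0)^*0(01+10+0)^*$ if and only if it is not one of $$1, 2, 3, 5, 6, 7, 9, 10, 11, 13, 14, 15, 19, 23, 27, 31, 47, 63, 79.$$ -/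

import Mathlib

/-- The canonical base-2 representation `(n)_2` of `n`, most significant digit first, without
leading zeros; the representation of `0` is the empty word. -/
def binaryRep (n : ℕ) : List ℕ := (Nat.digits 2 n).reverse

/-- The set `S_>` of natural numbers with more `0`s than `1`s in base 2. -/
def moreZerosThanOnes : Set ℕ := {n | (binaryRep n).count 1 < (binaryRep n).count 0}

/-- `n` is a sum of at most `m` elements of `S`, repetitions allowed; the empty sum is `0`. -/
def IsSumOfAtMost (S : Set ℕ) (m n : ℕ) : Prop :=
  ∃ s : Multiset ℕ, s.card ≤ m ∧ (∀ x ∈ s, x ∈ S) ∧ s.sum = n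

/-- `S` is an asymptotic additive basis of order `m`: every sufficiently large natural number is
a sum of at most `m` elements of `S`. -/
def IsAsymptoticAdditiveBasis (S : Set ℕ) (m : ℕ) : Prop :=
  ∃ N : ℕ, ∀ n : ℕ, N ≤ n → IsSumOfAtMost S m n

open scoped Computability in
/-- The regular language `10(01+10+0)*0(01+10+0)*`. -/
def languageL4 : Language ℕ :=
  {[1, 0]} * ({[0, 1]} + {[1, 0]} + {[0]} : Language ℕ)∗ * {[0]} *
    ({[0, 1]} + {[1, 0]} + {[0]} : Language ℕ)∗

/-- The natural numbers whose base-2 representation lies in `languageL4`. -/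
def numbersL4 : Set ℕ := {n | binaryRep n ∈ languageL4}

open scoped Computability

/-! ### Sums of at most two or three elements -/

/-! The set `numbersL4` lies in `moreZerosThanOnes` and is closed under x ↦ 2x and x ↦ 4x + 1. If m
= x + y + 2z with x, y, z in it, then 2m = 2x + 2y + 2(2z) and 2m + 1 = (4z + 1) + 2x + 2y have the
same form. A finite check on [80, 160) starts this induction (`exists_add_add_two_mul`); as 2z is
again in the set, three summands suffice from 80 on. Smaller n are checked directly. Two summands
fail for 2 ^ k - 1: they add without carries, so together they have k ones, yet each has fewer than
k / 2. -/

theorem IsSumOfAtMost.mono {S : Set ℕ} {m m' n : ℕ} (hm : m ≤ m') (h : IsSumOfAtMost S m n) :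
    IsSumOfAtMost S m' n := by
  obtain ⟨s, hc, hs, hn⟩ := h
  exact ⟨s, hc.trans hm, hs, hn⟩

theorem IsSumOfAtMost.mono_set {S T : Set ℕ} {m n : ℕ} (hST : S ⊆ T) (h : IsSumOfAtMost S m n) :
    IsSumOfAtMost T m n := by
  obtain ⟨s, hc, hs, hn⟩ := h
  exact ⟨s, hc, fun x hx => hST (hs x hx), hn⟩

/-- Zero summands can be dropped, so "at most three" becomes "exactly three, with 0 allowed", which
suits finite checks. -/
theorem isSumOfAtMost_three_of_insert_zero {S : Set ℕ} {x y z : ℕ} (hx : x ∈ insert 0 S)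
    (hy : y ∈ insert 0 S) (hz : z ∈ insert 0 S) : IsSumOfAtMost S 3 (x + y + z) := by
  refine ⟨({x, y, z} : Multiset ℕ).filter (· ≠ 0), ?_, ?_, ?_⟩
  · exact (Multiset.card_le_card (Multiset.filter_le _ _)).trans (by simp)
  · intro a ha
    simp only [Multiset.mem_filter, Multiset.insert_eq_cons, Multiset.mem_cons,
      Multiset.mem_singleton] at ha
    obtain ⟨h | h | h, h0⟩ := ha <;> subst h <;> simp_all
  · have h := Multiset.sum_filter_add_sum_filter_not (s := ({x, y, z} : Multiset ℕ)) (· ≠ 0)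
    have h0 : (({x, y, z} : Multiset ℕ).filter (fun a => ¬ a ≠ 0)).sum = 0 :=
      Multiset.sum_eq_zero fun a ha => by simpa using (Multiset.mem_filter.mp ha).2
    rw [h0, add_zero] at h
    rw [h]
    simp [add_assoc]

theorem IsSumOfAtMost.exists_insert_zero {S : Set ℕ} {n : ℕ} (h : IsSumOfAtMost S 3 n) :
    ∃ x ∈ insert 0 S, ∃ y ∈ insert 0 S, ∃ z ∈ insert 0 S, x + y + z = n := by
  obtain ⟨s, hc, hs, hn⟩ := h
  have h4 : s.card = 0 ∨ s.card = 1 ∨ s.card = 2 ∨ s.card = 3 := by omega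
  rw [Multiset.card_eq_zero, Multiset.card_eq_one, Multiset.card_eq_two,
    Multiset.card_eq_three] at h4
  rcases h4 with rfl | ⟨x, rfl⟩ | ⟨x, y, rfl⟩ | ⟨x, y, z, rfl⟩
  · exact ⟨0, by simp, 0, by simp, 0, by simp, by simpa using hn⟩
  · exact ⟨x, by simp_all, 0, by simp, 0, by simp, by simpa using hn⟩
  · exact ⟨x, by simp_all, y, by simp_all, 0, by simp, by simpa using hn⟩
  · exact ⟨x, by simp_all, y, by simp_all, z, by simp_all, by simpa [add_assoc] using hn⟩

theorem IsSumOfAtMost.exists_insert_zero_two {S : Set ℕ} {n : ℕ} (h : IsSumOfAtMost S 2 n) :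
    ∃ x ∈ insert 0 S, ∃ y ∈ insert 0 S, x + y = n := by
  obtain ⟨s, hc, hs, hn⟩ := h
  have h3 : s.card = 0 ∨ s.card = 1 ∨ s.card = 2 := by omega
  rw [Multiset.card_eq_zero, Multiset.card_eq_one, Multiset.card_eq_two] at h3
  rcases h3 with rfl | ⟨x, rfl⟩ | ⟨x, y, rfl⟩
  · exact ⟨0, by simp, 0, by simp, by simpa using hn⟩
  · exact ⟨x, by simp_all, 0, by simp, by simpa using hn⟩
  · exact ⟨x, by simp_all, y, by simp_all, by simpa using hn⟩

/-! ### Two summands do not suffice -/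

theorem List.count_zero_add_count_one_le_length (l : List ℕ) :
    l.count 0 + l.count 1 ≤ l.length := by
  induction l with
  | nil => simp
  | cons a l ih =>
    simp only [List.count_cons, List.length_cons, beq_iff_eq]
    split_ifs <;> omega

theorem mem_moreZerosThanOnes {n : ℕ} :
    n ∈ moreZerosThanOnes ↔ (Nat.digits 2 n).count 1 < (Nat.digits 2 n).count 0 := by
  simp [moreZerosThanOnes, binaryRep]

theorem count_one_digits_bit {b x : ℕ} (hb : b < 2) :
    (Nat.digits 2 (b + 2 * x)).count 1 = b + (Nat.digits 2 x).count 1 := by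
  by_cases h : b = 0 ∧ x = 0
  · simp [h.1, h.2]
  · rw [Nat.digits_add 2 (by norm_num) b x hb (by omega)]
    interval_cases b <;> simp [add_comm]

/-- Two numbers adding up to `2 ^ k - 1` have complementary binary digits. -/
theorem count_one_add_count_one {k x y : ℕ} (h : x + y + 1 = 2 ^ k) :
    (Nat.digits 2 x).count 1 + (Nat.digits 2 y).count 1 = k := by
  induction k generalizing x y with
  | zero =>
    have hx : x = 0 := by simp at h; omega
    have hy : y = 0 := by simp at h; omega
    simp [hx, hy]
  | succ k ih =>
    rw [pow_succ] at h
    -- The sum is odd, so exactly one last digit is 1 and nothing is carried into the halves.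
    have hk := @ih (x / 2) (y / 2) (by omega)
    have hx := @count_one_digits_bit (x % 2) (x / 2) (by omega)
    have hy := @count_one_digits_bit (y % 2) (y / 2) (by omega)
    rw [Nat.mod_add_div] at hx hy
    omega

theorem two_mul_count_one_lt {k x : ℕ} (hk : 0 < k) (hx : x ∈ insert 0 moreZerosThanOnes)
    (hlt : x < 2 ^ k) : 2 * (Nat.digits 2 x).count 1 < k := by
  rcases hx with rfl | hx
  · simpa using hk
  · rw [mem_moreZerosThanOnes] at hx
    have h1 := List.count_zero_add_count_one_le_length (Nat.digits 2 x)
    have h2 := (Nat.digits_length_le_iff (b := 2) (by norm_num) x (k := k)).mpr hlt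
    omega

theorem not_isSumOfAtMost_two {k : ℕ} (hk : 0 < k) :
    ¬ IsSumOfAtMost moreZerosThanOnes 2 (2 ^ k - 1) := by
  intro h
  obtain ⟨x, hx, y, hy, hxy⟩ := h.exists_insert_zero_two
  have hpos : 0 < 2 ^ k := by positivity
  have h1 := count_one_add_count_one (k := k) (x := x) (y := y) (by omega)
  have h2 := two_mul_count_one_lt hk hx (by omega)
  have h3 := two_mul_count_one_lt hk hy (by omega)
  omega

/-! ### The language `L₄` -/

/-- The blocks `01`, `10`, `0` that are repeated in `languageL4`. -/
def blocksL4 : Language ℕ := {[0, 1]} + {[1, 0]} + {[0]}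

theorem mem_blocksL4 {w : List ℕ} : w ∈ blocksL4 ↔ w = [0, 1] ∨ w = [1, 0] ∨ w = [0] := by
  simp only [blocksL4, Language.mem_add, or_assoc]
  rfl

theorem mem_languageL4 {w : List ℕ} : w ∈ languageL4 ↔
    ∃ u ∈ blocksL4∗, ∃ v ∈ blocksL4∗, w = [1, 0] ++ u ++ [0] ++ v := by
  change w ∈ {[1, 0]} * blocksL4∗ * {[0]} * blocksL4∗ ↔ _
  simp only [Language.mem_mul]
  constructor
  · rintro ⟨_, ⟨_, ⟨_, rfl, u, hu, rfl⟩, _, rfl, rfl⟩, v, hv, rfl⟩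
    exact ⟨u, hu, v, hv, rfl⟩
  · rintro ⟨u, hu, v, hv, rfl⟩
    exact ⟨_, ⟨_, ⟨_, rfl, u, hu, rfl⟩, _, rfl, rfl⟩, v, hv, rfl⟩

theorem append_mem_languageL4 {w v : List ℕ} (hw : w ∈ languageL4) (hv : v ∈ blocksL4) :
    w ++ v ∈ languageL4 := by
  obtain ⟨a, ha, b, hb, rfl⟩ := mem_languageL4.mp hw
  obtain ⟨L, rfl, hL⟩ := Language.mem_kstar.mp hb
  refine mem_languageL4.mpr ⟨a, ha, (L ++ [v]).flatten, Language.mem_kstar.mpr ⟨_, rfl, ?_⟩, ?_⟩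
  · intro y hy
    rcases List.mem_append.mp hy with hy | hy
    · exact hL y hy
    · rwa [List.mem_singleton.mp hy]
  · simp

theorem count_one_le_count_zero_of_mem_kstar {w : List ℕ} (hw : w ∈ blocksL4∗) :
    w.count 1 ≤ w.count 0 := by
  obtain ⟨L, rfl, hL⟩ := Language.mem_kstar.mp hw
  clear hw
  induction L with
  | nil => simp
  | cons v L ih =>
    have hv := mem_blocksL4.mp (hL v (by simp))
    have hL' := ih fun y hy => hL y (by simp [hy])
    rw [List.flatten_cons, List.count_append, List.count_append]
    rcases hv with rfl | rfl | rfl <;> simp <;> omega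

theorem count_one_lt_count_zero_of_mem_languageL4 {w : List ℕ} (hw : w ∈ languageL4) :
    w.count 1 < w.count 0 := by
  obtain ⟨u, hu, v, hv, rfl⟩ := mem_languageL4.mp hw
  have h1 := count_one_le_count_zero_of_mem_kstar hu
  have h2 := count_one_le_count_zero_of_mem_kstar hv
  simp only [List.count_append]
  simp
  omega

theorem numbersL4_subset_moreZerosThanOnes : numbersL4 ⊆ moreZerosThanOnes :=
  fun _ hx => count_one_lt_count_zero_of_mem_languageL4 hx

theorem take_two_of_mem_languageL4 {w : List ℕ} (hw : w ∈ languageL4) : w.take 2 = [1, 0] := by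
  obtain ⟨u, hu, v, hv, rfl⟩ := mem_languageL4.mp hw
  simp

/-- The word ends in the separate 0 or in a block, and neither allows the ending 11. This excludes
67 = 1000011. -/
theorem take_two_reverse_ne_of_mem_languageL4 {w : List ℕ} (hw : w ∈ languageL4) :
    w.reverse.take 2 ≠ [1, 1] := by
  obtain ⟨u, hu, v, hv, rfl⟩ := mem_languageL4.mp hw
  obtain ⟨L, rfl, hL⟩ := Language.mem_kstar.mp hv
  rcases L.eq_nil_or_concat with rfl | ⟨L, b, rfl⟩
  · simp
  · rcases mem_blocksL4.mp (hL b (by simp)) with rfl | rfl | rfl <;> simp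

/-! ### Closure properties of the numbers with representation in `L₄` -/

theorem binaryRep_bit {b x : ℕ} (hb : b < 2) (hx : x ≠ 0) :
    binaryRep (b + 2 * x) = binaryRep x ++ [b] := by
  rw [binaryRep, Nat.digits_add 2 (by norm_num) b x hb (Or.inr hx), List.reverse_cons, binaryRep]

theorem ne_zero_of_mem_numbersL4 {x : ℕ} (hx : x ∈ numbersL4) : x ≠ 0 := by
  rintro rfl
  simpa [binaryRep] using take_two_of_mem_languageL4 hx

theorem four_mem_numbersL4 : 4 ∈ numbersL4 := by
  have h : binaryRep 4 = [1, 0] ++ [] ++ [0] ++ [] := by simp [binaryRep]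
  exact mem_languageL4.mpr ⟨[], Language.nil_mem_kstar _, [], Language.nil_mem_kstar _, h⟩

theorem two_mul_mem_numbersL4 {x : ℕ} (hx : x ∈ numbersL4) : 2 * x ∈ numbersL4 := by
  have h := binaryRep_bit (b := 0) (by norm_num) (ne_zero_of_mem_numbersL4 hx)
  rw [zero_add] at h
  change binaryRep _ ∈ languageL4
  rw [h]
  exact append_mem_languageL4 hx (mem_blocksL4.mpr (by simp))

theorem four_mul_add_one_mem_numbersL4 {x : ℕ} (hx : x ∈ numbersL4) :
    4 * x + 1 ∈ numbersL4 := by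
  have h0 := ne_zero_of_mem_numbersL4 hx
  have h : binaryRep (4 * x + 1) = binaryRep x ++ [0, 1] := by
    rw [show 4 * x + 1 = 1 + 2 * (0 + 2 * x) by ring, binaryRep_bit (by norm_num) (by omega),
      binaryRep_bit (by norm_num) h0, List.append_assoc, List.singleton_append]
  change binaryRep _ ∈ languageL4
  rw [h]
  exact append_mem_languageL4 hx (mem_blocksL4.mpr (by simp))

theorem four_mul_add_two_mem_numbersL4 {x : ℕ} (hx : x ∈ numbersL4) :
    4 * x + 2 ∈ numbersL4 := by
  have h0 := ne_zero_of_mem_numbersL4 hx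
  have h : binaryRep (4 * x + 2) = binaryRep x ++ [1, 0] := by
    rw [show 4 * x + 2 = 0 + 2 * (1 + 2 * x) by ring, binaryRep_bit (by norm_num) (by omega),
      binaryRep_bit (by norm_num) h0, List.append_assoc, List.singleton_append]
  change binaryRep _ ∈ languageL4
  rw [h]
  exact append_mem_languageL4 hx (mem_blocksL4.mpr (by simp))

/-- The closure maps do not produce 20 = 10100 from 4, so it needs its own factorization 10·10·0. -/
theorem twenty_mem_numbersL4 : 20 ∈ numbersL4 := by
  have h : binaryRep 20 = [1, 0] ++ [[1, 0]].flatten ++ [0] ++ [] := by simp [binaryRep]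
  exact mem_languageL4.mpr ⟨_, Language.mem_kstar.mpr ⟨[[1, 0]], rfl, by simp [mem_blocksL4]⟩,
    [], Language.nil_mem_kstar _, h⟩

/-- Elements of `numbersL4` that are enough to represent the small numbers. -/
def smallNumbersL4 : List ℕ := [4, 8, 16, 17, 18, 20, 33, 40, 69, 70]

theorem mem_numbersL4_of_mem_smallNumbersL4 {x : ℕ} (hx : x ∈ smallNumbersL4) :
    x ∈ numbersL4 := by
  have h4 := four_mem_numbersL4
  have h8 := two_mul_mem_numbersL4 h4
  have h17 := four_mul_add_one_mem_numbersL4 h4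
  simp only [smallNumbersL4, List.mem_cons, List.not_mem_nil, or_false] at hx
  rcases hx with rfl | rfl | rfl | rfl | rfl | rfl | rfl | rfl | rfl | rfl
  · exact h4
  · exact h8
  · exact two_mul_mem_numbersL4 h8
  · exact h17
  · exact four_mul_add_two_mem_numbersL4 h4
  · exact twenty_mem_numbersL4
  · exact four_mul_add_one_mem_numbersL4 h8
  · exact two_mul_mem_numbersL4 twenty_mem_numbersL4
  · exact four_mul_add_one_mem_numbersL4 h17
  · exact four_mul_add_two_mem_numbersL4 h17

/-! ### Three summands suffice -/

theorem exists_add_add_two_mul_of_lt :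
    ∀ n < 160, 80 ≤ n → ∃ x ∈ smallNumbersL4, ∃ y ∈ smallNumbersL4, ∃ z ∈ smallNumbersL4,
      x + y + 2 * z = n := by
  decide +kernel

/-- The invariant `n = x + y + 2 z` passes from `m` to both `2 m` and `2 m + 1`. -/
theorem exists_add_add_two_mul {n : ℕ} (hn : 80 ≤ n) :
    ∃ x ∈ numbersL4, ∃ y ∈ numbersL4, ∃ z ∈ numbersL4, x + y + 2 * z = n := by
  induction n using Nat.strong_induction_on with
  | _ n ih =>
    by_cases h : n < 160
    · obtain ⟨x, hx, y, hy, z, hz, e⟩ := exists_add_add_two_mul_of_lt n h hn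
      exact ⟨x, mem_numbersL4_of_mem_smallNumbersL4 hx, y, mem_numbersL4_of_mem_smallNumbersL4 hy,
        z, mem_numbersL4_of_mem_smallNumbersL4 hz, e⟩
    · obtain ⟨x, hx, y, hy, z, hz, e⟩ := ih (n / 2) (by omega) (by omega)
      rcases Nat.mod_two_eq_zero_or_one n with h0 | h1
      · exact ⟨2 * x, two_mul_mem_numbersL4 hx, 2 * y, two_mul_mem_numbersL4 hy,
          2 * z, two_mul_mem_numbersL4 hz, by omega⟩
      -- The old doubled term absorbs the odd digit as 4z + 1, and y takes over the doubled place.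
      · exact ⟨4 * z + 1, four_mul_add_one_mem_numbersL4 hz, 2 * x, two_mul_mem_numbersL4 hx,
          y, hy, by omega⟩

theorem exists_smallNumbersL4_of_lt :
    ∀ n < 80, n ∉ [1, 2, 3, 5, 6, 7, 9, 10, 11, 13, 14, 15, 19, 23, 27, 31, 47, 63, 79] →
      ∃ x ∈ 0 :: smallNumbersL4, ∃ y ∈ 0 :: smallNumbersL4, ∃ z ∈ 0 :: smallNumbersL4,
        x + y + z = n := by
  decide +kernel

theorem isSumOfAtMost_numbersL4 {n : ℕ}
    (hn : n ∉ [1, 2, 3, 5, 6, 7, 9, 10, 11, 13, 14, 15, 19, 23, 27, 31, 47, 63, 79]) :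
    IsSumOfAtMost numbersL4 3 n := by
  by_cases h : n < 80
  · have key : ∀ a ∈ 0 :: smallNumbersL4, a ∈ insert 0 numbersL4 := by
      intro a ha
      rcases List.mem_cons.mp ha with rfl | ha
      · exact Set.mem_insert _ _
      · exact Set.mem_insert_of_mem _ (mem_numbersL4_of_mem_smallNumbersL4 ha)
    obtain ⟨x, hx, y, hy, z, hz, rfl⟩ := exists_smallNumbersL4_of_lt n h hn
    exact isSumOfAtMost_three_of_insert_zero (key x hx) (key y hy) (key z hz)
  · obtain ⟨x, hx, y, hy, z, hz, rfl⟩ := exists_add_add_two_mul (not_lt.mp h)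
    exact isSumOfAtMost_three_of_insert_zero (Set.mem_insert_of_mem _ hx)
      (Set.mem_insert_of_mem _ hy) (Set.mem_insert_of_mem _ (two_mul_mem_numbersL4 hz))

theorem isSumOfAtMost_moreZerosThanOnes {n : ℕ}
    (hn : n ∉ [1, 2, 3, 5, 6, 7, 9, 10, 11, 13, 14, 15, 19, 23, 27, 31, 47, 63]) :
    IsSumOfAtMost moreZerosThanOnes 3 n := by
  by_cases h : n = 79
  -- 79 = 67 + 4 + 8, where 67 is not in `numbersL4`.
  · have h67 : (67 : ℕ) ∈ moreZerosThanOnes := by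
      rw [mem_moreZerosThanOnes]
      simp
    have h4 := numbersL4_subset_moreZerosThanOnes four_mem_numbersL4
    have h8 := numbersL4_subset_moreZerosThanOnes (two_mul_mem_numbersL4 four_mem_numbersL4)
    rw [h]
    exact isSumOfAtMost_three_of_insert_zero (Set.mem_insert_of_mem _ h67)
      (Set.mem_insert_of_mem _ h4) (Set.mem_insert_of_mem _ h8)
  · exact (isSumOfAtMost_numbersL4 (by simp_all)).mono_set numbersL4_subset_moreZerosThanOnes

/-! ### The exceptions -/

theorem mem_moreZerosThanOnes_lt_eighty : ∀ x < 80,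
    (Nat.digits 2 x).count 1 < (Nat.digits 2 x).count 0 →
      x ∈ [4, 8, 16, 17, 18, 20, 24, 32, 33, 34, 36, 40, 48, 64, 65, 66, 67, 68, 69, 70, 72, 73,
        74, 76] := by
  decide +kernel

theorem mem_of_mem_numbersL4_lt_eighty {x : ℕ} (hx : x ∈ numbersL4) (hlt : x < 80) :
    x ∈ [4, 8, 16, 17, 18, 20, 32, 33, 34, 36, 40, 64, 65, 66, 68, 69, 70, 72, 73, 74, 76] := by
  have h := mem_moreZerosThanOnes_lt_eighty x hlt
    (mem_moreZerosThanOnes.mp (numbersL4_subset_moreZerosThanOnes hx))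
  have h24 : x ≠ 24 := by
    rintro rfl
    simpa [binaryRep] using take_two_of_mem_languageL4 hx
  have h48 : x ≠ 48 := by
    rintro rfl
    simpa [binaryRep] using take_two_of_mem_languageL4 hx
  have h67 : x ≠ 67 := by
    rintro rfl
    simpa [binaryRep] using take_two_reverse_ne_of_mem_languageL4 hx
  simp only [List.mem_cons, List.not_mem_nil, or_false] at h ⊢
  omega

theorem moreZerosThanOnes_sum_ne :
    ∀ x ∈ [0, 4, 8, 16, 17, 18, 20, 24, 32, 33, 34, 36, 40, 48],
    ∀ y ∈ [0, 4, 8, 16, 17, 18, 20, 24, 32, 33, 34, 36, 40, 48],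
    ∀ z ∈ [0, 4, 8, 16, 17, 18, 20, 24, 32, 33, 34, 36, 40, 48],
      x + y + z ∉ [1, 2, 3, 5, 6, 7, 9, 10, 11, 13, 14, 15, 19, 23, 27, 31, 47, 63] := by
  decide +kernel

theorem numbersL4_sum_ne :
    ∀ x ∈ [0, 4, 8, 16, 17, 18, 20, 32, 33, 34, 36, 40, 64, 65, 66, 68, 69, 70, 72, 73, 74, 76],
    ∀ y ∈ [0, 4, 8, 16, 17, 18, 20, 32, 33, 34, 36, 40, 64, 65, 66, 68, 69, 70, 72, 73, 74, 76],
    ∀ z ∈ [0, 4, 8, 16, 17, 18, 20, 32, 33, 34, 36, 40, 64, 65, 66, 68, 69, 70, 72, 73, 74, 76],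
      x + y + z ≠ 79 := by
  decide +kernel

theorem not_isSumOfAtMost_moreZerosThanOnes {n : ℕ}
    (hn : n ∈ [1, 2, 3, 5, 6, 7, 9, 10, 11, 13, 14, 15, 19, 23, 27, 31, 47, 63]) :
    ¬ IsSumOfAtMost moreZerosThanOnes 3 n := by
  intro h
  have hle : n ≤ 63 := by
    simp only [List.mem_cons, List.not_mem_nil, or_false] at hn
    omega
  obtain ⟨x, hx, y, hy, z, hz, rfl⟩ := h.exists_insert_zero
  have key : ∀ a ∈ insert 0 moreZerosThanOnes, a ≤ 63 →
      a ∈ [0, 4, 8, 16, 17, 18, 20, 24, 32, 33, 34, 36, 40, 48] := by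
    rintro a (rfl | ha) hlt
    · simp
    · have := mem_moreZerosThanOnes_lt_eighty a (by omega) (mem_moreZerosThanOnes.mp ha)
      simp only [List.mem_cons, List.not_mem_nil, or_false] at this ⊢
      omega
  exact moreZerosThanOnes_sum_ne x (key x hx (by omega)) y (key y hy (by omega))
    z (key z hz (by omega)) hn

theorem not_isSumOfAtMost_numbersL4_seventy_nine : ¬ IsSumOfAtMost numbersL4 3 79 := by
  intro h
  obtain ⟨x, hx, y, hy, z, hz, e⟩ := h.exists_insert_zero
  have key : ∀ a ∈ insert 0 numbersL4, a ≤ 79 → a ∈ [0, 4, 8, 16, 17, 18, 20, 32, 33, 34, 36, 40,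
      64, 65, 66, 68, 69, 70, 72, 73, 74, 76] := by
    rintro a (rfl | ha) hlt
    · simp
    · exact List.mem_cons_of_mem _ (mem_of_mem_numbersL4_lt_eighty ha (by omega))
  exact numbersL4_sum_ne x (key x hx (by omega)) y (key y hy (by omega))
    z (key z hz (by omega)) e

theorem isAsymptoticAdditiveBasis_three : IsAsymptoticAdditiveBasis moreZerosThanOnes 3 := by
  refine ⟨64, fun n hn => isSumOfAtMost_moreZerosThanOnes ?_⟩
  simp only [List.mem_cons, List.not_mem_nil, or_false]
  omega

theorem not_isAsymptoticAdditiveBasis_two {m : ℕ} (hm : m ≤ 2) :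
    ¬ IsAsymptoticAdditiveBasis moreZerosThanOnes m := by
  rintro ⟨N, hN⟩
  have hlt : N + 1 < 2 ^ (N + 1) := Nat.lt_two_pow_self
  -- The counterexample beyond N is 2 ^ (N + 1) - 1.
  exact not_isSumOfAtMost_two N.succ_pos ((hN _ (by omega)).mono hm)

theorem mainTheorem6 :
    (∀ n : ℕ, IsSumOfAtMost moreZerosThanOnes 3 n ↔
      n ∉ ({1, 2, 3, 5, 6, 7, 9, 10, 11, 13, 14, 15, 19, 23, 27, 31, 47, 63} : Set ℕ)) ∧
    IsLeast {m : ℕ | IsAsymptoticAdditiveBasis moreZerosThanOnes m} 3 ∧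
    (∀ n : ℕ, IsSumOfAtMost numbersL4 3 n ↔
      n ∉ ({1, 2, 3, 5, 6, 7, 9, 10, 11, 13, 14, 15, 19, 23, 27, 31, 47, 63, 79} : Set ℕ)) := by
  refine ⟨fun n => ⟨fun h hn => ?_, fun hn => ?_⟩,
    ⟨isAsymptoticAdditiveBasis_three, fun m hm => ?_⟩, fun n => ⟨fun h hn => ?_, fun hn => ?_⟩⟩
  · exact not_isSumOfAtMost_moreZerosThanOnes (by simpa using hn) h
  · exact isSumOfAtMost_moreZerosThanOnes (by simpa using hn)
  · by_contra h3
    exact not_isAsymptoticAdditiveBasis_two (by omega) hm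
  · by_cases h79 : n = 79
    · exact not_isSumOfAtMost_numbersL4_seventy_nine (h79 ▸ h)
    · refine not_isSumOfAtMost_moreZerosThanOnes ?_ (h.mono_set numbersL4_subset_moreZerosThanOnes)
      simpa [h79] using hn
  · exact isSumOfAtMost_numbersL4 (by simpa using hn)
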